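/- Conventions. All spheres $\mathbb S^r$ ($r\ge 0$) are the unit spheres in $\mathbb R^{r+1}$. A topological space $X$ has $\dim X\le d$ if for every closed subspace $K\subseteq X$ and every $r\ge d$, every continuous map $K\to\mathbb S^r$ extends to a continuous map $X\to\mathbb S^r$. It is $d$-coconnected if for every $r\ge d$ every continuous map $X\to\mathbb S^r$ is homotopic to a constant map. It is $k$-connected if it is non-empty and for every integer $0\le i\le k$ every continuous map from $\mathbb S^i$ to it is homotopic to a constant map. A geodesic metric space $X$ is convex if for all geodesics $c_1,c_2:[0,1]\to X$ parameterized proportionally to arc length, the function $t\mapsto d(c_1(t),c_2(t))$ is convex; for instance, $\mathrm{CAT}(0)$ spaces (geodesic spaces in which geodesic triangles are no fatter than their Euclidean comparison triangles) are convex. A subset of $X$ is convex if it contains every geodesic segment joining two of its points. Let $\mathcal C=(C_i)_{i\in\mathbf n}$ be a finite family of subsets of a metric space $X$. A non-empty $J\subseteq\mathbf n$ is admissible if $C^J:=\bigcap_{j\in J}C_j\ne\emptyset$. The nerve $\mathcal N(\mathcal C)$ is (the geometric realization of) the simplicial complex whose simplices are the admissible sets of indices. The family $\mathcal C$ is sufficiently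 connected if for every admissible $I$ the space $C^I$ is connected when $I$ is a maximal admissible set, and is $h(I)$-connected otherwise, where $h(I)=\max\{|J|-|I| : I\subseteq J,\ J \text{ admissible}\}-1$. Theorem. Let $d\ge 0$ be an integer, let $X$ be a metric space with $\dim X\le d$, and let $\mathcal C$ be a finite family of closed subsets of $X$. (1) If $X$ is $d$-coconnected and $\mathcal C$ is sufficiently connected, then for every $r\ge d$ every continuous map $\mathcal N(\mathcal C)\to\mathbb S^r$ is homotopic to a constant map. (2) If $X$ is a complete convex metric space (for example a complete $\mathrm{CAT}(0)$ space) and every member of $\mathcal C$ is convex, then for every $r\ge d$ every continuous map $\mathcal N(\mathcal C)\to\mathbb S^r$ is homotopic to a constant map. -/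

import Mathlib

/-! ### Spheres, dimension, coconnectedness, connectivity -/

/-- The unit sphere `S^r` in `ℝ^(r+1)`. -/
abbrev UnitSphere (r : ℕ) : Type :=
  Metric.sphere (0 : EuclideanSpace ℝ (Fin (r + 1))) 1

/-- `dim X ≤ d`: every continuous map from a closed subspace of `X` to a sphere of dimension
`r ≥ d` extends continuously to `X`. -/
def DimLE (X : Type*) [TopologicalSpace X] (d : ℕ) : Prop :=
  ∀ K : Set X, IsClosed K → ∀ r : ℕ, d ≤ r → ∀ f : C(K, UnitSphere r),
    ∃ F : C(X, UnitSphere r), ∀ x : K, F x = f x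

/-- `X` is `d`-coconnected: every continuous map from `X` to a sphere of dimension `r ≥ d` is
homotopic to a constant map. -/
def IsCoconnected (X : Type*) [TopologicalSpace X] (d : ℕ) : Prop :=
  ∀ r : ℕ, d ≤ r → ∀ f : C(X, UnitSphere r), f.Nullhomotopic

/-- `Y` is `k`-connected: it is non-empty and every continuous map `S^i → Y` with `i ≤ k` is
homotopic to a constant map. -/
def IsKConnected (k : ℤ) (Y : Type*) [TopologicalSpace Y] : Prop :=
  Nonempty Y ∧ ∀ i : ℕ, (i : ℤ) ≤ k → ∀ f : C(UnitSphere i, Y), f.Nullhomotopic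

/-! ### Simplicial complexes and nerves -/

/-- The geometric realization of a simplicial complex on a finite set of potential vertices, by
barycentric coordinates: the points of the standard simplex whose support is a face. -/
def PreAbstractSimplicialComplex.realization {ι : Type*} [Fintype ι]
    (K : PreAbstractSimplicialComplex ι) : Set (ι → ℝ) :=
  {w | w ∈ stdSimplex ℝ ι ∧ ∃ s ∈ K.faces, ∀ i, i ∈ s ↔ w i ≠ 0}

/-- A set `J` of indices is admissible for the family `C` if it is non-empty and the members of
`C` indexed by `J` have a common point. -/
def IsAdmissible {ι X : Type*} (C : ι → Set X) (J : Finset ι) : Prop :=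
  J.Nonempty ∧ (⋂ j ∈ J, C j).Nonempty

/-- The nerve of a family of sets: the simplicial complex of admissible index sets. -/
def nerveComplex {ι X : Type*} (C : ι → Set X) : PreAbstractSimplicialComplex ι where
  faces := {J | IsAdmissible C J}
  isRelLowerSet_faces := fun _ hJ =>
    ⟨hJ.1, fun _ hsub hne => ⟨hne, hJ.2.mono (Set.biInter_mono hsub fun _ _ => subset_rfl)⟩⟩

open Classical in
/-- `h(I) = max {|J| - |I| : I ⊆ J, J admissible} - 1`, for `I` admissible. -/
noncomputable def coheight {ι X : Type*} [Fintype ι] (C : ι → Set X) (I : Finset ι) : ℤ :=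
  (((Finset.univ.filter fun J : Finset ι => I ⊆ J ∧ IsAdmissible C J).sup
    fun J => J.card - I.card : ℕ) : ℤ) - 1

/-- The family `C` is sufficiently connected: for each admissible `I`, the intersection of the
members of `C` indexed by `I` is connected if `I` is maximal and `h(I)`-connected otherwise. -/
def SufficientlyConnected {ι X : Type*} [Fintype ι] [TopologicalSpace X] (C : ι → Set X) : Prop :=
  ∀ I : Finset ι, IsAdmissible C I →
    (Maximal (IsAdmissible C) I → IsConnected (⋂ i ∈ I, C i)) ∧
    (¬ Maximal (IsAdmissible C) I → IsKConnected (coheight C I) ↥(⋂ i ∈ I, C i))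

/-! ### Geodesics, convex metrics, CAT(0) spaces -/

/-- `c` restricted to `[0,1]` is a geodesic parameterized proportionally to arc length. Only the
values of `c` on `[0,1]` matter. -/
def IsGeodesic {X : Type*} [MetricSpace X] (c : ℝ → X) : Prop :=
  ∀ s ∈ Set.Icc (0 : ℝ) 1, ∀ t ∈ Set.Icc (0 : ℝ) 1, dist (c s) (c t) = |s - t| * dist (c 0) (c 1)

/-- Any two points of `X` are joined by a geodesic. -/
def IsGeodesicSpace (X : Type*) [MetricSpace X] : Prop :=
  ∀ x y : X, ∃ c : ℝ → X, IsGeodesic c ∧ c 0 = x ∧ c 1 = y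

/-- A convex metric space: a geodesic space such that `t ↦ d(c₁(t), c₂(t))` is convex on `[0,1]`
for all geodesics `c₁, c₂ : [0,1] → X` parameterized proportionally to arc length. -/
def IsConvexMetricSpace (X : Type*) [MetricSpace X] : Prop :=
  IsGeodesicSpace X ∧ ∀ c₁ c₂ : ℝ → X, IsGeodesic c₁ → IsGeodesic c₂ →
    ConvexOn ℝ (Set.Icc (0 : ℝ) 1) fun t => dist (c₁ t) (c₂ t)

/-- A subset is convex if it contains every geodesic segment joining two of its points. -/
def IsGeodesicallyConvex {X : Type*} [MetricSpace X] (Y : Set X) : Prop :=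
  ∀ c : ℝ → X, IsGeodesic c → c 0 ∈ Y → c 1 ∈ Y → ∀ t ∈ Set.Icc (0 : ℝ) 1, c t ∈ Y

/-- A CAT(0) space: a geodesic space in which the distance between two points on sides of a
geodesic triangle is at most the distance between the corresponding points of a Euclidean
comparison triangle `P Q R`. Two distinct sides share a vertex, here `c₁ 0 = c₂ 0`; for two points
on one side there is nothing to require. -/
def IsCATZeroSpace (X : Type*) [MetricSpace X] : Prop :=
  IsGeodesicSpace X ∧ ∀ c₁ c₂ : ℝ → X, IsGeodesic c₁ → IsGeodesic c₂ → c₁ 0 = c₂ 0 →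
    ∀ P Q R : EuclideanSpace ℝ (Fin 2),
      dist P Q = dist (c₁ 0) (c₁ 1) → dist P R = dist (c₂ 0) (c₂ 1) →
      dist Q R = dist (c₁ 1) (c₂ 1) →
      ∀ s ∈ Set.Icc (0 : ℝ) 1, ∀ t ∈ Set.Icc (0 : ℝ) 1,
        dist (c₁ s) (c₂ t) ≤ dist (AffineMap.lineMap P Q s) (AffineMap.lineMap P R t)

/-! Let `A` be the union of the family, a closed set, and `N` the nerve. The proof constructs maps
`Φ : A → N` and `Ψ : N → A` with `Φ ∘ Ψ` homotopic to the identity. Given `f : N → S^r` with `r ≥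
d`, the map `f ∘ Φ` extends to `X` because `dim X ≤ d`, and the extension is nullhomotopic because
`X` is `d`-coconnected. Composing with `Ψ`, so is `f ∘ Φ ∘ Ψ`, which is homotopic to `f`.

The map `Φ` normalizes bump functions that are positive on the `C i` and whose open supports have no
new intersections (`exists_bump_functions`). The map `Ψ` comes from a cubical model of the nerve,
with a face `[I, J]` of dimension `|J \ I|` for `I ⊆ J`, `I` non-empty and `J` admissible
(`SufficientlyConnected.exists_map`). The face `[I, J]` is sent into `C^I`. Its proper subfaces
`[I', J']` have `I ⊆ I'`, so their images already lie in `C^I`, and filling in a boundary sphere of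
dimension `|J \ I| - 1 ≤ h(I)` is what sufficient connectedness permits.

For convex families, every non-empty intersection, and `X` itself when non-empty, contracts along
geodesics, so the second statement follows from the first. -/

/-! ### Extending and gluing continuous maps -/

/-- A nullhomotopic map on the unit sphere extends to the whole Euclidean space. -/
theorem ContinuousMap.Nullhomotopic.exists_extension {Y : Type*} [TopologicalSpace Y] {r : ℕ}
    {f : C(UnitSphere r, Y)} (hf : f.Nullhomotopic) :
    ∃ F : EuclideanSpace ℝ (Fin (r + 1)) → Y, Continuous F ∧ ∀ x : UnitSphere r, F x = f x := by
  classical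
  obtain ⟨y, ⟨H⟩⟩ := hf
  have hne : ∀ x : {x : EuclideanSpace ℝ (Fin (r + 1)) // 1 / 2 ≤ ‖x‖}, ‖x.1‖ ≠ 0 := fun x => by
    have := x.2
    intro h
    rw [h] at this
    norm_num at this
  let u : {x : EuclideanSpace ℝ (Fin (r + 1)) // 1 / 2 ≤ ‖x‖} → UnitSphere r := fun x =>
    ⟨‖x.1‖⁻¹ • x.1, by
      rw [mem_sphere_zero_iff_norm, norm_smul, norm_inv, norm_norm, inv_mul_cancel₀ (hne x)]⟩
  have hu : Continuous u := by
    have hinv : Continuous fun x : {x : EuclideanSpace ℝ (Fin (r + 1)) // 1 / 2 ≤ ‖x‖} =>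
        ‖x.1‖⁻¹ := (continuous_norm.comp continuous_subtype_val).inv₀ hne
    exact (hinv.smul continuous_subtype_val).subtype_mk _
  -- The homotopy runs inwards along radii: time 0 at norm 1 (and, by clamping, beyond), time 1 at
  -- norm 1/2, where it meets the constant `y`. The origin, where `u` would be undefined, is thus
  -- avoided.
  let τ : EuclideanSpace ℝ (Fin (r + 1)) → unitInterval := fun x =>
    Set.projIcc 0 1 zero_le_one (2 - 2 * ‖x‖)
  have hτ : Continuous τ := continuous_projIcc.comp (f := fun x : EuclideanSpace ℝ (Fin (r + 1)) => 2 - 2 * ‖x‖)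
    (by fun_prop)
  refine ⟨fun x => if h : 1 / 2 ≤ ‖x‖ then H (τ x, u ⟨x, h⟩) else y, ?_, fun x => ?_⟩
  · rw [← continuousOn_univ]
    have huniv : (Set.univ : Set (EuclideanSpace ℝ (Fin (r + 1)))) =
        {x | 1 / 2 ≤ ‖x‖} ∪ {x | ‖x‖ ≤ 1 / 2} := by
      ext x
      simpa using le_total _ _
    rw [huniv]
    refine ContinuousOn.union_of_isClosed ?_ ?_ (isClosed_le continuous_const continuous_norm)
      (isClosed_le continuous_norm continuous_const)
    · rw [continuousOn_iff_continuous_domRestrict]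
      have : Continuous fun x : {x : EuclideanSpace ℝ (Fin (r + 1)) // 1 / 2 ≤ ‖x‖} =>
          H (τ x, u x) := H.continuous.comp ((hτ.comp continuous_subtype_val).prodMk hu)
      refine this.congr fun x => ?_
      rw [Set.domRestrict_apply, dif_pos x.2]
    · refine (continuousOn_const (c := y)).congr fun x hx => ?_
      dsimp only
      split_ifs with h
      · have hx' : ‖x‖ = 1 / 2 := le_antisymm hx h
        have : τ x = 1 := by
          simp only [τ, hx']
          norm_num
        rw [this, H.apply_one, ContinuousMap.const_apply]
      · rfl
  · have hx : ‖x.1‖ = 1 := mem_sphere_zero_iff_norm.mp x.2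
    have h : 1 / 2 ≤ ‖x.1‖ := by rw [hx]; norm_num
    have h0 : τ x = 0 := by
      simp only [τ, hx]
      norm_num
    have h1 : u ⟨x, h⟩ = x := Subtype.ext (by simp [u, hx])
    dsimp only
    rw [dif_pos h, h0, h1, H.apply_zero]

/-- A continuous map from the frontier of a bounded convex body into a set in which all spheres of
the right dimension are nullhomotopic extends to the whole space. -/
theorem exists_extension_of_frontier {X : Type*} [TopologicalSpace X] {Y : Set X} {r : ℕ}
    (hY : ∀ f : C(UnitSphere r, Y), f.Nullhomotopic)
    {s : Set (EuclideanSpace ℝ (Fin (r + 1)))} (hc : Convex ℝ s) (hne : (interior s).Nonempty)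
    (hb : Bornology.IsBounded s) {f : EuclideanSpace ℝ (Fin (r + 1)) → X}
    (hf : ContinuousOn f (frontier s)) (hfY : Set.MapsTo f (frontier s) Y) :
    ∃ F : EuclideanSpace ℝ (Fin (r + 1)) → X, Continuous F ∧ (∀ x, F x ∈ Y) ∧
      Set.EqOn F f (frontier s) := by
  obtain ⟨h, -, -, hs⟩ := exists_homeomorph_image_interior_closure_frontier_eq_unitBall hc hne hb
  have hmem : ∀ x : UnitSphere r, h.symm x ∈ frontier s := fun x => by
    have hx : (x : EuclideanSpace ℝ (Fin (r + 1))) ∈ h '' frontier s := by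
      rw [hs]
      exact x.2
    obtain ⟨z, hz, hzx⟩ := hx
    rwa [← hzx, h.symm_apply_apply]
  let g : C(UnitSphere r, Y) :=
    ⟨fun x => ⟨f (h.symm x), hfY (hmem x)⟩, by
      refine Continuous.subtype_mk ?_ _
      exact hf.comp_continuous (h.symm.continuous.comp continuous_subtype_val) hmem⟩
  obtain ⟨G, hG, hGg⟩ := (hY g).exists_extension
  refine ⟨fun x => G (h x), continuous_subtype_val.comp (hG.comp h.continuous),
    fun x => (G (h x)).2, fun x hx => ?_⟩
  have hx' : h x ∈ Metric.sphere (0 : EuclideanSpace ℝ (Fin (r + 1))) 1 := by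
    rw [← hs]
    exact ⟨x, hx, rfl⟩
  have := hGg ⟨h x, hx'⟩
  dsimp only at this ⊢
  rw [this]
  simp [g]

/-- The version of `exists_extension_of_frontier` for the unit cube. -/
theorem exists_extension_of_cube {X : Type*} [TopologicalSpace X] {Y : Set X} {n : ℕ}
    (hne : Y.Nonempty) (hY : ∀ r : ℕ, n = r + 1 → ∀ f : C(UnitSphere r, Y), f.Nullhomotopic)
    {f : (Fin n → ℝ) → X}
    (hf : ContinuousOn f {x | (∀ k, x k ∈ Set.Icc (0 : ℝ) 1) ∧ ∃ k, x k = 0 ∨ x k = 1})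
    (hfY : Set.MapsTo f {x | (∀ k, x k ∈ Set.Icc (0 : ℝ) 1) ∧ ∃ k, x k = 0 ∨ x k = 1} Y) :
    ∃ F : (Fin n → ℝ) → X, Continuous F ∧ (∀ x, F x ∈ Y) ∧
      Set.EqOn F f {x | (∀ k, x k ∈ Set.Icc (0 : ℝ) 1) ∧ ∃ k, x k = 0 ∨ x k = 1} := by
  -- A 0-cube has empty boundary, so a point of `Y` is all that is needed.
  rcases n with _ | r
  · obtain ⟨y, hy⟩ := hne
    exact ⟨fun _ => y, continuous_const, fun _ => hy, fun x ⟨_, k, _⟩ => k.elim0⟩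
  let e := PiLp.homeomorph 2 (fun _ : Fin (r + 1) => ℝ)
  let s : Set (EuclideanSpace ℝ (Fin (r + 1))) :=
    e ⁻¹' Set.univ.pi fun _ => Set.Icc (0 : ℝ) 1
  have hint : interior s = e ⁻¹' Set.univ.pi fun _ => Set.Ioo (0 : ℝ) 1 := by
    rw [← e.preimage_interior, interior_pi_set Set.finite_univ]
    simp
  have hclosed : IsClosed s :=
    (isClosed_set_pi fun _ _ => isClosed_Icc).preimage e.continuous
  have hfr : frontier s = e ⁻¹' {x | (∀ k, x k ∈ Set.Icc (0 : ℝ) 1) ∧ ∃ k, x k = 0 ∨ x k = 1} := by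
    rw [hclosed.frontier_eq, hint]
    ext x
    simp only [s, Set.mem_sdiff, Set.mem_preimage, Set.mem_univ_pi, Set.mem_ofPred_eq, not_forall]
    refine and_congr_right fun hx => exists_congr fun k => ?_
    have := hx k
    simp only [Set.mem_Icc, Set.mem_Ioo, not_and_or, not_lt] at this ⊢
    constructor
    · rintro (h | h)
      · exact Or.inl (le_antisymm h this.1)
      · exact Or.inr (le_antisymm this.2 h)
    · rintro (h | h)
      · exact Or.inl h.le
      · exact Or.inr h.ge
  have hconv : Convex ℝ s := by
    intro x hx y hy a b ha hb hab
    simp only [s, Set.mem_preimage, Set.mem_univ_pi] at hx hy ⊢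
    exact fun k => convex_Icc (0 : ℝ) 1 (hx k) (hy k) ha hb hab
  have hbdd : Bornology.IsBounded s :=
    (e.isCompact_preimage.2 (isCompact_univ_pi fun _ => isCompact_Icc)).isBounded
  have hnon : (interior s).Nonempty := by
    rw [hint]
    refine ⟨e.symm fun _ => 1 / 2, ?_⟩
    simp only [Set.mem_preimage, Homeomorph.apply_symm_apply, Set.mem_univ_pi]
    intro _
    norm_num
  obtain ⟨F, hF, hFY, hFf⟩ := exists_extension_of_frontier (hY r rfl) hconv hnon hbdd
    (f := f ∘ e) (hf.comp e.continuous.continuousOn (by rw [hfr]; exact fun x hx => hx))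
    (by rw [hfr]; exact fun x hx => hfY hx)
  refine ⟨F ∘ e.symm, hF.comp e.symm.continuous, fun x => hFY _, fun x hx => ?_⟩
  have := hFf (x := e.symm x) (by rw [hfr]; simpa using hx)
  simpa using this

open Classical in
/-- Continuous maps on finitely many closed sets `D k`, which meet pairwise inside a closed set `B`
and on which they agree with a given map, can be glued. -/
theorem exists_glue {Z X κ : Type*} [TopologicalSpace Z] [TopologicalSpace X] [Finite κ]
    {B : Set Z} (hB : IsClosed B) {D : κ → Set Z} (hD : ∀ k, IsClosed (D k))
    (hDB : ∀ j k, j ≠ k → D j ∩ D k ⊆ B) {f : Z → X} (hf : ContinuousOn f B)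
    {g : κ → Z → X} (hg : ∀ k, ContinuousOn (g k) (D k))
    (hgf : ∀ k, Set.EqOn (g k) f (D k ∩ B)) :
    ∃ F : Z → X, ContinuousOn F (B ∪ ⋃ k, D k) ∧ Set.EqOn F f B ∧
      ∀ k, Set.EqOn F (g k) (D k) := by
  let F : Z → X := fun z =>
    if z ∈ B then f z else if h : ∃ k, z ∈ D k then g h.choose z else f z
  have hFB : Set.EqOn F f B := fun z hz => if_pos hz
  have hFD : ∀ k, Set.EqOn F (g k) (D k) := fun k z hz => by
    by_cases hzB : z ∈ B
    · rw [hFB hzB, hgf k ⟨hz, hzB⟩]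
    · have h : ∃ k, z ∈ D k := ⟨k, hz⟩
      -- Off `B` a point lies in only one of the `D k`, so the choice is forced.
      have hk : h.choose = k := by
        by_contra hne
        exact hzB (hDB _ _ hne ⟨h.choose_spec, hz⟩)
      simp only [F, if_neg hzB, dif_pos h, hk]
  refine ⟨F, ?_, hFB, hFD⟩
  refine (hf.congr hFB).union_of_isClosed ?_ hB (isClosed_iUnion_of_finite hD)
  exact (locallyFinite_of_finite D).continuousOn_iUnion hD fun k => (hg k).congr (hFD k)

/-! ### The cubical nerve and the map built on its skeleta -/

section Cubes

open Classical

variable {ι : Type*}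

/-- The coordinates at which `w` takes the value `1`. -/
noncomputable def oneSet [Fintype ι] (w : ι → ℝ) : Finset ι :=
  Finset.univ.filter fun i => w i = 1

/-- The coordinates at which `w` does not vanish. -/
noncomputable def suppSet [Fintype ι] (w : ι → ℝ) : Finset ι :=
  Finset.univ.filter fun i => w i ≠ 0

@[simp] theorem mem_oneSet [Fintype ι] {w : ι → ℝ} {i : ι} : i ∈ oneSet w ↔ w i = 1 := by
  simp [oneSet]

@[simp] theorem mem_suppSet [Fintype ι] {w : ι → ℝ} {i : ι} : i ∈ suppSet w ↔ w i ≠ 0 := by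
  simp [suppSet]

theorem oneSet_subset_suppSet [Fintype ι] (w : ι → ℝ) : oneSet w ⊆ suppSet w := fun i hi => by
  rw [mem_oneSet] at hi
  simp [hi]

/-- The face of the unit cube on which the coordinates in `I` are `1` and those outside `J`
vanish. -/
def cubeFace (I J : Finset ι) : Set (ι → ℝ) :=
  {w | (∀ i, w i ∈ Set.Icc (0 : ℝ) 1) ∧ (∀ i ∈ I, w i = 1) ∧ ∀ i, i ∉ J → w i = 0}

theorem isClosed_cubeFace (I J : Finset ι) : IsClosed (cubeFace I J) := by
  have h : cubeFace I J = (⋂ i, {w : ι → ℝ | w i ∈ Set.Icc (0 : ℝ) 1}) ∩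
      ((⋂ i ∈ I, {w : ι → ℝ | w i = 1}) ∩ ⋂ i, ⋂ _ : i ∉ J, {w : ι → ℝ | w i = 0}) := by
    ext w
    simp [cubeFace]
  rw [h]
  refine (isClosed_iInter fun i => isClosed_Icc.preimage (continuous_apply i)).inter
    ((isClosed_biInter fun i _ => ?_).inter (isClosed_iInter fun i => isClosed_iInter fun _ => ?_))
  · exact isClosed_eq (continuous_apply i) continuous_const
  · exact isClosed_eq (continuous_apply i) continuous_const

theorem subset_oneSet [Fintype ι] {I J : Finset ι} {w : ι → ℝ} (hw : w ∈ cubeFace I J) :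
    I ⊆ oneSet w :=
  fun i hi => mem_oneSet.2 (hw.2.1 i hi)

theorem suppSet_subset [Fintype ι] {I J : Finset ι} {w : ι → ℝ} (hw : w ∈ cubeFace I J) :
    suppSet w ⊆ J :=
  fun i hi => by
    by_contra h
    exact mem_suppSet.1 hi (hw.2.2 i h)

theorem sdiff_subset [Fintype ι] {I J : Finset ι} {w : ι → ℝ} (hw : w ∈ cubeFace I J) :
    suppSet w \ oneSet w ⊆ J \ I :=
  Finset.sdiff_subset_sdiff (suppSet_subset hw) (subset_oneSet hw)

theorem mem_cubeFace_self [Fintype ι] {w : ι → ℝ} (hw : ∀ i, w i ∈ Set.Icc (0 : ℝ) 1) :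
    w ∈ cubeFace (oneSet w) (suppSet w) :=
  ⟨hw, fun _ hi => mem_oneSet.1 hi, fun i hi => by simpa using hi⟩

/-- A point of a cube face whose number of free coordinates is the dimension of the face
determines the face. -/
theorem eq_of_card_sdiff_le [Fintype ι] {I J : Finset ι} {w : ι → ℝ} (hw : w ∈ cubeFace I J)
    (h : (J \ I).card ≤ (suppSet w \ oneSet w).card) : I = oneSet w ∧ J = suppSet w := by
  have heq := Finset.eq_of_subset_of_card_le (sdiff_subset hw) h
  have h1 := subset_oneSet hw
  have h2 := suppSet_subset hw
  have h3 := oneSet_subset_suppSet w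
  refine ⟨h1.antisymm fun i hi => ?_, Finset.Subset.antisymm (fun i hi => ?_) h2⟩
  · by_contra hiI
    have : i ∈ suppSet w \ oneSet w := heq ▸ Finset.mem_sdiff.2 ⟨h2 (h3 hi), hiI⟩
    exact (Finset.mem_sdiff.1 this).2 hi
  · by_cases hiI : i ∈ I
    · exact h3 (h1 hiI)
    · have : i ∈ suppSet w \ oneSet w := heq ▸ Finset.mem_sdiff.2 ⟨hi, hiI⟩
      exact (Finset.mem_sdiff.1 this).1

/-- In the induction over skeleta, this identifies the part of a face lying in the lower skeleton
with the boundary of the face. -/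
theorem card_sdiff_lt_iff [Fintype ι] {I J : Finset ι} {w : ι → ℝ} (hw : w ∈ cubeFace I J) :
    (suppSet w \ oneSet w).card < (J \ I).card ↔ ∃ i ∈ J \ I, w i = 0 ∨ w i = 1 := by
  constructor
  · intro h
    obtain ⟨i, hi, hi'⟩ := Finset.exists_mem_notMem_of_card_lt_card h
    refine ⟨i, hi, ?_⟩
    by_contra hc
    rw [not_or] at hc
    exact hi' (Finset.mem_sdiff.2 ⟨mem_suppSet.2 hc.1, fun h => hc.2 (mem_oneSet.1 h)⟩)
  · rintro ⟨i, hi, h⟩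
    refine Finset.card_lt_card ((Finset.ssubset_iff_of_subset (sdiff_subset hw)).2 ⟨i, hi, ?_⟩)
    simp only [Finset.mem_sdiff, mem_suppSet, mem_oneSet]
    tauto

/-- Extension of a map from the boundary of a cube face to the whole face. -/
theorem exists_extension_of_cubeFace {X : Type*} [TopologicalSpace X] {Y : Set X} {I J : Finset ι}
    (hIJ : I ⊆ J) (hne : Y.Nonempty)
    (hY : ∀ r : ℕ, (J \ I).card = r + 1 → ∀ f : C(UnitSphere r, Y), f.Nullhomotopic)
    {B : Set (ι → ℝ)} (hB : ∀ w ∈ cubeFace I J, w ∈ B ↔ ∃ i ∈ J \ I, w i = 0 ∨ w i = 1)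
    {f : (ι → ℝ) → X} (hf : ContinuousOn f B) (hfY : Set.MapsTo f (cubeFace I J ∩ B) Y) :
    ∃ F : (ι → ℝ) → X, Continuous F ∧ (∀ x, F x ∈ Y) ∧ Set.EqOn F f (cubeFace I J ∩ B) := by
  -- The coordinates in `J \ I` are the free ones; `emb` parametrizes the face by them and `pr`
  -- reads them off.
  let e : {i // i ∈ J \ I} ≃ Fin (J \ I).card := (J \ I).equivFin
  let emb : (Fin (J \ I).card → ℝ) → (ι → ℝ) := fun x i =>
    if h : i ∈ J \ I then x (e ⟨i, h⟩) else if i ∈ I then 1 else 0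
  let pr : (ι → ℝ) → (Fin (J \ I).card → ℝ) := fun w k => w (e.symm k)
  have hemb : Continuous emb := by
    refine continuous_pi fun i => ?_
    by_cases h : i ∈ J \ I
    · simp only [emb, dif_pos h]
      exact continuous_apply _
    · simp only [emb, dif_neg h]
      exact continuous_const
  have hpr : Continuous pr := continuous_pi fun k => continuous_apply _
  have hep : ∀ w ∈ cubeFace I J, emb (pr w) = w := fun w hw => by
    funext i
    by_cases h : i ∈ J \ I
    · simp only [emb, dif_pos h, pr, e.symm_apply_apply]
    · simp only [emb, dif_neg h]
      split_ifs with hI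
      · exact (hw.2.1 i hI).symm
      · exact (hw.2.2 i fun hJ => h (Finset.mem_sdiff.2 ⟨hJ, hI⟩)).symm
  have hmem : ∀ x : Fin (J \ I).card → ℝ, (∀ k, x k ∈ Set.Icc (0 : ℝ) 1) →
      emb x ∈ cubeFace I J := fun x hx => by
    refine ⟨fun i => ?_, fun i hi => ?_, fun i hi => ?_⟩
    · by_cases h : i ∈ J \ I
      · simp only [emb, dif_pos h]
        exact hx _
      · simp only [emb, dif_neg h]
        split_ifs <;> simp
    · have h : i ∉ J \ I := fun h => (Finset.mem_sdiff.1 h).2 hi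
      simp only [emb, dif_neg h, if_pos hi]
    · have h : i ∉ J \ I := fun h => hi (Finset.mem_sdiff.1 h).1
      simp only [emb, dif_neg h, if_neg fun h => hi (hIJ h)]
  have hmemB : Set.MapsTo emb {x | (∀ k, x k ∈ Set.Icc (0 : ℝ) 1) ∧ ∃ k, x k = 0 ∨ x k = 1}
      (cubeFace I J ∩ B) := by
    rintro x ⟨hx, k, hk⟩
    refine ⟨hmem x hx, (hB _ (hmem x hx)).2 ⟨e.symm k, (e.symm k).2, ?_⟩⟩
    simpa only [emb, dif_pos (e.symm k).2, Subtype.coe_eta, e.apply_symm_apply] using hk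
  obtain ⟨F, hF, hFY, hFf⟩ := exists_extension_of_cube hne hY (f := f ∘ emb)
    (hf.comp hemb.continuousOn fun x hx => (hmemB hx).2) fun x hx => hfY (hmemB hx)
  refine ⟨F ∘ pr, hF.comp hpr, fun x => hFY _, fun w hw => ?_⟩
  have hw' : pr w ∈ {x : Fin (J \ I).card → ℝ |
      (∀ k, x k ∈ Set.Icc (0 : ℝ) 1) ∧ ∃ k, x k = 0 ∨ x k = 1} := by
    obtain ⟨i, hi, h⟩ := (hB w hw.1).1 hw.2
    refine ⟨fun k => hw.1.1 _, e ⟨i, hi⟩, ?_⟩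
    simpa only [pr, e.symm_apply_apply] using h
  rw [Function.comp_apply, hFf hw', Function.comp_apply, hep w hw.1]

/-- The cubical model of the nerve: the points of the unit cube with some coordinate `1` and
admissible support. -/
def cubicalNerve [Fintype ι] {X : Type*} (C : ι → Set X) : Set (ι → ℝ) :=
  {w | (∀ i, w i ∈ Set.Icc (0 : ℝ) 1) ∧ (∃ i, w i = 1) ∧ IsAdmissible C (suppSet w)}

theorem IsAdmissible.mono {X : Type*} {C : ι → Set X} {I J : Finset ι} (hJ : IsAdmissible C J)
    (hI : I.Nonempty) (hIJ : I ⊆ J) : IsAdmissible C I :=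
  ⟨hI, hJ.2.mono (Set.biInter_mono hIJ fun _ _ => subset_rfl)⟩

theorem cubeFace_subset_cubicalNerve [Fintype ι] {X : Type*} {C : ι → Set X} {I J : Finset ι}
    (hI : I.Nonempty) (hJ : IsAdmissible C J) : cubeFace I J ⊆ cubicalNerve C := by
  intro w hw
  obtain ⟨i, hi⟩ := hI
  have h1 := subset_oneSet hw hi
  exact ⟨hw.1, ⟨i, mem_oneSet.1 h1⟩,
    hJ.mono ⟨i, oneSet_subset_suppSet w h1⟩ (suppSet_subset hw)⟩

/-- Since `J` strictly contains `I`, the set `I` is not maximal, and `J` competes in the maximum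
defining `h(I)`; hence `r = |J| - |I| - 1 ≤ h(I)`. -/
theorem SufficientlyConnected.nullhomotopic [Fintype ι] {X : Type*} [TopologicalSpace X]
    {C : ι → Set X}
    (hC : SufficientlyConnected C) {I J : Finset ι} (hI : I.Nonempty) (hIJ : I ⊆ J)
    (hJ : IsAdmissible C J) {r : ℕ} (hr : (J \ I).card = r + 1)
    (f : C(UnitSphere r, ↥(⋂ i ∈ I, C i))) : f.Nullhomotopic := by
  have hadm : IsAdmissible C I := hJ.mono hI hIJ
  have hmax : ¬ Maximal (IsAdmissible C) I := fun h => by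
    have : J \ I = ∅ := Finset.sdiff_eq_empty_iff_subset.2 (h.2 hJ hIJ)
    simp [this] at hr
  refine (((hC I hadm).2 hmax).2 r ?_) f
  rw [Finset.card_sdiff_of_subset hIJ] at hr
  have hsup : J.card - I.card ≤ (Finset.univ.filter fun J : Finset ι => I ⊆ J ∧
      IsAdmissible C J).sup fun J => J.card - I.card :=
    Finset.le_sup (f := fun J : Finset ι => J.card - I.card) (by simp [hIJ, hJ])
  rw [hr] at hsup
  unfold coheight
  have : ((r + 1 : ℕ) : ℤ) ≤ _ := Nat.cast_le.2 hsup
  push_cast at this ⊢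
  linarith

/-- A sufficiently connected family admits a continuous map from the cubical nerve which sends
`w` into the intersection of the members with `w i = 1`. -/
theorem SufficientlyConnected.exists_map [Fintype ι] {X : Type*} [TopologicalSpace X]
    [Nonempty X] {C : ι → Set X} (hC : SufficientlyConnected C) :
    ∃ ψ : (ι → ℝ) → X, ContinuousOn ψ (cubicalNerve C) ∧
      ∀ w ∈ cubicalNerve C, ∀ i, w i = 1 → ψ w ∈ C i := by
  -- A point lies in the relative interior of the face `[oneSet w, suppSet w]`; `skel n` collects
  -- the faces of dimension strictly below `n`, so `skel 0` is empty.
  let skel : ℕ → Set (ι → ℝ) := fun n =>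
    {w | w ∈ cubicalNerve C ∧ (suppSet w \ oneSet w).card < n}
  suffices h : ∀ n, IsClosed (skel n) ∧ ∃ ψ : (ι → ℝ) → X, ContinuousOn ψ (skel n) ∧
      ∀ w ∈ skel n, ∀ i, w i = 1 → ψ w ∈ C i by
    obtain ⟨-, ψ, hψ, hψC⟩ := h (Fintype.card ι + 1)
    have : skel (Fintype.card ι + 1) = cubicalNerve C :=
      Set.ext fun w => and_iff_left (Nat.lt_succ_of_le (Finset.card_le_univ _))
    rw [this] at hψ hψC
    exact ⟨ψ, hψ, hψC⟩
  intro n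
  induction n with
  | zero =>
    have : skel 0 = ∅ := by ext w; simp [skel]
    rw [this]
    exact ⟨isClosed_empty, fun _ => Classical.arbitrary X, continuousOn_empty _, by simp⟩
  | succ n ih =>
    obtain ⟨hcl, ψ, hψ, hψC⟩ := ih
    let κ := {p : Finset ι × Finset ι //
      p.1.Nonempty ∧ p.1 ⊆ p.2 ∧ IsAdmissible C p.2 ∧ (p.2 \ p.1).card = n}
    let D : κ → Set (ι → ℝ) := fun p => cubeFace p.1.1 p.1.2
    have hD : ∀ p, IsClosed (D p) := fun p => isClosed_cubeFace _ _
    have hunion : skel (n + 1) = skel n ∪ ⋃ p, D p := by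
      ext w
      constructor
      · rintro ⟨hw, hwn⟩
        rcases Nat.lt_succ_iff_lt_or_eq.1 hwn with h | h
        · exact Or.inl ⟨hw, h⟩
        · obtain ⟨i, hi⟩ := hw.2.1
          refine Or.inr (Set.mem_iUnion.2 ⟨⟨(oneSet w, suppSet w), ⟨i, mem_oneSet.2 hi⟩,
            oneSet_subset_suppSet w, hw.2.2, h⟩, mem_cubeFace_self hw.1⟩)
      · rintro (h | h)
        · exact ⟨h.1, h.2.trans (Nat.lt_succ_self n)⟩
        · obtain ⟨p, hp⟩ := Set.mem_iUnion.1 h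
          refine ⟨cubeFace_subset_cubicalNerve p.2.1 p.2.2.2.1 hp, Nat.lt_succ_of_le ?_⟩
          exact (Finset.card_le_card (sdiff_subset hp)).trans_eq p.2.2.2.2
    have hext : ∀ p : κ, ∃ F : (ι → ℝ) → X, Continuous F ∧ (∀ x, F x ∈ ⋂ i ∈ p.1.1, C i) ∧
        Set.EqOn F ψ (D p ∩ skel n) := by
      rintro ⟨⟨I, J⟩, hI, hIJ, hJ, hn⟩
      refine exists_extension_of_cubeFace hIJ (hJ.mono hI hIJ).2
        (fun r hr => hC.nullhomotopic hI hIJ hJ hr) (fun w hw => ?_) hψ fun w hw => ?_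
      · rw [← card_sdiff_lt_iff hw]
        exact ⟨fun h => h.2.trans_eq hn.symm,
          fun h => ⟨cubeFace_subset_cubicalNerve hI hJ hw, h.trans_eq hn⟩⟩
      · exact Set.mem_iInter₂.2 fun i hi => hψC w hw.2 i (hw.1.2.1 i hi)
    choose g hg hgY hgψ using hext
    -- A point outside the lower skeleton has `n` free coordinates and so determines its
    -- `n`-dimensional face.
    have hDB : ∀ p q, p ≠ q → D p ∩ D q ⊆ skel n := by
      intro p q hpq w hw
      refine ⟨cubeFace_subset_cubicalNerve p.2.1 p.2.2.2.1 hw.1, ?_⟩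
      by_contra hlt
      rw [not_lt] at hlt
      have h1 := eq_of_card_sdiff_le hw.1 (p.2.2.2.2.trans_le hlt)
      have h2 := eq_of_card_sdiff_le hw.2 (q.2.2.2.2.trans_le hlt)
      exact hpq (Subtype.ext (Prod.ext (h1.1.trans h2.1.symm) (h1.2.trans h2.2.symm)))
    obtain ⟨F, hF, hFψ, hFg⟩ := exists_glue hcl hD hDB hψ (fun p => (hg p).continuousOn) hgψ
    rw [hunion]
    refine ⟨hcl.union (isClosed_iUnion_of_finite hD), F, hF, fun w hw i hi => ?_⟩
    by_cases hwB : w ∈ skel n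
    · rw [hFψ hwB]
      exact hψC w hwB i hi
    · obtain ⟨p, hp⟩ := Set.mem_iUnion.1 (hw.resolve_left hwB)
      have hlt : n ≤ (suppSet w \ oneSet w).card := by
        by_contra h
        exact hwB ⟨cubeFace_subset_cubicalNerve p.2.1 p.2.2.2.1 hp, not_le.1 h⟩
      have h1 := eq_of_card_sdiff_le hp (p.2.2.2.2.trans_le hlt)
      rw [hFg p hp]
      exact Set.mem_iInter₂.1 (hgY p w) i (h1.1 ▸ mem_oneSet.2 hi)

end Cubes

/-! ### Maps to and from the nerve, and the coconnected case -/

section Nerve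

variable {ι X : Type*} [Fintype ι] {C : ι → Set X}

theorem mem_realization_of_suppSet_subset {w : ι → ℝ} (hw : w ∈ stdSimplex ℝ ι) {J : Finset ι}
    (hJ : IsAdmissible C J) (h : suppSet w ⊆ J) : w ∈ (nerveComplex C).realization := by
  refine ⟨hw, suppSet w, hJ.mono ?_ h, fun i => mem_suppSet⟩
  by_contra hne
  rw [Finset.not_nonempty_iff_eq_empty] at hne
  have hz : ∀ i, w i = 0 := fun i => by
    by_contra hi
    exact Finset.notMem_empty i (hne ▸ mem_suppSet.2 hi)
  have := hw.2
  simp [hz] at this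

theorem isAdmissible_suppSet (p : (nerveComplex C).realization) :
    IsAdmissible C (suppSet p.1) := by
  obtain ⟨-, s, hs, h⟩ := p.2
  have : suppSet p.1 = s := by
    ext i
    rw [mem_suppSet, h]
  rw [this]
  exact hs

/-- Maps to the nerve which are pointwise contained in a common simplex are homotopic. -/
theorem homotopic_of_suppSet_subset {Z : Type*} [TopologicalSpace Z]
    (a b : C(Z, (nerveComplex C).realization))
    (h : ∀ z, ∃ J, IsAdmissible C J ∧ suppSet (a z).1 ⊆ J ∧ suppSet (b z).1 ⊆ J) :
    a.Homotopic b := by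
  -- The straight-line homotopy stays inside the common simplex.
  refine ⟨⟨⟨fun q => ⟨(1 - (q.1 : ℝ)) • (a q.2).1 + (q.1 : ℝ) • (b q.2).1, ?_⟩, ?_⟩, ?_, ?_⟩⟩
  · obtain ⟨J, hJ, ha, hb⟩ := h q.2
    refine mem_realization_of_suppSet_subset ?_ hJ fun i hi => ?_
    · exact convex_stdSimplex ℝ ι (a q.2).2.1 (b q.2).2.1 (sub_nonneg.2 q.1.2.2) q.1.2.1
        (sub_add_cancel _ _)
    · by_contra hiJ
      have h1 : (a q.2).1 i = 0 := by
        by_contra hne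
        exact hiJ (ha (mem_suppSet.2 hne))
      have h2 : (b q.2).1 i = 0 := by
        by_contra hne
        exact hiJ (hb (mem_suppSet.2 hne))
      exact mem_suppSet.1 hi (by simp [h1, h2])
  · fun_prop
  · intro z
    simp
  · intro z
    simp

/-- A continuous family of nonzero nonnegative weights with admissible supports can be normalized
to a map to the nerve. -/
theorem exists_normalized_map {Z : Type*} [TopologicalSpace Z] {v : Z → ι → ℝ}
    (hv : Continuous v) (hnonneg : ∀ z i, 0 ≤ v z i) (hpos : ∀ z, ∃ i, 0 < v z i)
    (hadm : ∀ z, IsAdmissible C (suppSet (v z))) :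
    ∃ a : C(Z, (nerveComplex C).realization), ∀ z, suppSet (a z).1 = suppSet (v z) := by
  have hsum : ∀ z, 0 < ∑ i, v z i := fun z => by
    obtain ⟨i, hi⟩ := hpos z
    exact Finset.sum_pos' (fun i _ => hnonneg z i) ⟨i, Finset.mem_univ i, hi⟩
  have hsupp : ∀ z, suppSet ((∑ i, v z i)⁻¹ • v z) = suppSet (v z) := fun z => by
    ext i
    simp [(hsum z).ne']
  refine ⟨⟨fun z => ⟨(∑ i, v z i)⁻¹ • v z, ?_⟩, ?_⟩, hsupp⟩
  · refine mem_realization_of_suppSet_subset ⟨fun i => ?_, ?_⟩ (hadm z) (hsupp z).subset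
    · exact mul_nonneg (inv_nonneg.2 (hsum z).le) (hnonneg z i)
    · simp only [Pi.smul_apply, smul_eq_mul, ← Finset.mul_sum]
      exact inv_mul_cancel₀ (hsum z).ne'
  · refine Continuous.subtype_mk (Continuous.smul (Continuous.inv₀ ?_ fun z => (hsum z).ne') hv) _
    exact continuous_finsetSum _ fun i _ => (continuous_apply i).comp hv

/-- Given finitely many closed sets, there are continuous functions, positive on each of them,
whose open supports have the same nerve. -/
theorem exists_bump_functions {ι X : Type*} [Finite ι] [MetricSpace X] {C : ι → Set X}
    (hC : ∀ i, IsClosed (C i)) :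
    ∃ φ : ι → X → ℝ, (∀ i, Continuous (φ i)) ∧ (∀ i x, 0 ≤ φ i x) ∧
      (∀ i, ∀ x ∈ C i, 0 < φ i x) ∧
      ∀ (x : X) (J : Finset ι), J.Nonempty → (∀ i ∈ J, 0 < φ i x) → IsAdmissible C J := by
  classical
  cases nonempty_fintype ι
  -- `Metric.infDist` to the empty set is 0; the value 1 keeps `g i` positive off `C i` in that case
  -- too.
  let g : ι → X → ℝ := fun i x => if (C i).Nonempty then Metric.infDist x (C i) else 1
  have hg : ∀ i, Continuous (g i) := fun i => by
    by_cases h : (C i).Nonempty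
    · simp only [g, if_pos h]
      exact Metric.continuous_infDist_pt _
    · simp only [g, if_neg h]
      exact continuous_const
  have hg0 : ∀ i, ∀ x ∈ C i, g i x = 0 := fun i x hx => by
    have h : (C i).Nonempty := ⟨x, hx⟩
    simp only [g, if_pos h, Metric.infDist_zero_of_mem hx]
  have hgpos : ∀ i, ∀ x ∉ C i, 0 < g i x := fun i x hx => by
    by_cases h : (C i).Nonempty
    · simp only [g, if_pos h]
      exact ((hC i).notMem_iff_infDist_pos h).1 hx
    · simp [g, if_neg h]
  -- For non-admissible `J` the `C j` have no common point, so the largest `g j x` with `j ∈ J` is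
  -- positive. The function `m` is a minimum of finitely many such maxima; truncating `m - g i` at 0
  -- then leaves no point where all `j ∈ J` are positive.
  have hm : ∀ 𝒥 : Finset (Finset ι), (∀ J ∈ 𝒥, J.Nonempty ∧ ¬ IsAdmissible C J) →
      ∃ m : X → ℝ, Continuous m ∧ (∀ x, 0 < m x) ∧ ∀ J ∈ 𝒥, ∀ x, ∃ j ∈ J, m x ≤ g j x := by
    intro 𝒥
    induction 𝒥 using Finset.induction_on with
    | empty => exact fun _ => ⟨fun _ => 1, continuous_const, fun _ => one_pos, by simp⟩
    | insert J 𝒥 _ ih =>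
      intro h
      obtain ⟨m, hmc, hmpos, hm⟩ := ih fun J hJ => h J (Finset.mem_insert_of_mem hJ)
      obtain ⟨hne, hJ⟩ := h J (Finset.mem_insert_self _ _)
      refine ⟨fun x => min (m x) (J.sup' hne fun j => g j x), ?_, fun x => ?_, ?_⟩
      · exact hmc.min (Continuous.finset_sup'_apply hne fun j _ => hg j)
      · refine lt_min (hmpos x) ((Finset.lt_sup'_iff hne).2 ?_)
        by_contra hc
        push Not at hc
        refine hJ ⟨hne, x, Set.mem_iInter₂.2 fun j hj => ?_⟩
        by_contra hx
        exact (hgpos j x hx).not_ge (hc j hj)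
      · intro K hK x
        rcases Finset.mem_insert.1 hK with rfl | hK
        · obtain ⟨j, hj, hjx⟩ := Finset.exists_mem_eq_sup' hne fun j => g j x
          exact ⟨j, hj, (min_le_right _ _).trans_eq hjx⟩
        · obtain ⟨j, hj, hjx⟩ := hm K hK x
          exact ⟨j, hj, (min_le_left _ _).trans hjx⟩
  obtain ⟨m, hmc, hmpos, hm⟩ := hm
    (Finset.univ.filter fun J => J.Nonempty ∧ ¬ IsAdmissible C J) (by simp)
  refine ⟨fun i x => max 0 (m x - g i x), fun i => continuous_const.max (hmc.sub (hg i)),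
    fun i x => le_max_left _ _, fun i x hx => ?_, fun x J hne hJ => ?_⟩
  · simp [hg0 i x hx, hmpos x]
  · by_contra hadm
    obtain ⟨j, hj, hjx⟩ := hm J (by simp [hne, hadm]) x
    have : 0 < max 0 (m x - g j x) := hJ j hj
    rw [max_eq_left (sub_nonpos.2 hjx)] at this
    exact this.false

/-- Maps from the nerve of a sufficiently connected finite closed family in a `d`-coconnected
metric space of dimension at most `d` to spheres of dimension at least `d` are nullhomotopic. -/
theorem SufficientlyConnected.nerve_isCoconnected {X : Type*} [MetricSpace X] {C : ι → Set X}
    {d : ℕ} (hdim : DimLE X d) (hclosed : ∀ i, IsClosed (C i)) (hX : IsCoconnected X d)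
    (hC : SufficientlyConnected C) : IsCoconnected (nerveComplex C).realization d := by
  intro r hr f
  rcases isEmpty_or_nonempty (nerveComplex C).realization with hN | hN
  · let y : UnitSphere r := ⟨EuclideanSpace.single 0 1, by simp⟩
    have : f = ContinuousMap.const _ y := by
      ext1 p
      exact hN.elim p
    rw [this]
    exact ContinuousMap.nullhomotopic_of_constant y
  have hXne : Nonempty X := by
    obtain ⟨p⟩ := hN
    obtain ⟨-, x, -⟩ := isAdmissible_suppSet p
    exact ⟨x⟩
  obtain ⟨φ, hφ, hφ0, hφC, hφadm⟩ := exists_bump_functions hclosed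
  obtain ⟨ψ, hψ, hψC⟩ := hC.exists_map
  let A : Set X := ⋃ i, C i
  have hA : IsClosed A := isClosed_iUnion_of_finite hclosed
  have hφA : ∀ x : A, ∃ i, 0 < φ i x := fun x => by
    obtain ⟨i, hi⟩ := Set.mem_iUnion.1 x.2
    exact ⟨i, hφC i x hi⟩
  have hsuppφ : ∀ x : A, IsAdmissible C (suppSet fun i => φ i x) := fun x => by
    obtain ⟨i, hi⟩ := hφA x
    exact hφadm x _ ⟨i, mem_suppSet.2 hi.ne'⟩ fun j hj =>
      (hφ0 j x).lt_of_ne (mem_suppSet.1 hj).symm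
  obtain ⟨Φ, hΦ⟩ := exists_normalized_map (C := C) (v := fun (x : A) i => φ i x)
    (continuous_pi fun i => (hφ i).comp continuous_subtype_val) (fun x i => hφ0 i x) hφA hsuppφ
  have hnn : ∀ (p : (nerveComplex C).realization) (i : ι), 0 ≤ p.1 i := fun p i => p.2.1.1 i
  have hmax : ∀ p : (nerveComplex C).realization, ∃ i, p.1 i = ‖p.1‖ ∧ 0 < ‖p.1‖ := fun p => by
    obtain ⟨i, hi⟩ := (isAdmissible_suppSet p).1
    have : Nonempty ι := ⟨i⟩
    obtain ⟨j, hj⟩ := Finite.exists_max fun i => p.1 i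
    have hpos : 0 < ‖p.1‖ := norm_pos_iff.2 fun h => mem_suppSet.1 hi (by rw [h]; rfl)
    refine ⟨j, le_antisymm ((le_abs_self _).trans (norm_le_pi_norm p.1 j)) ?_, hpos⟩
    exact (pi_norm_le_iff_of_nonneg (hnn p j)).2 fun i => by
      rw [Real.norm_of_nonneg (hnn p i)]
      exact hj i
  have hnormpos : ∀ p : (nerveComplex C).realization, 0 < ‖p.1‖ := fun p => (hmax p).choose_spec.2
  have hcoord : ∀ i, Continuous fun p : (nerveComplex C).realization => p.1 i / ‖p.1‖ := fun i =>
    ((continuous_apply i).comp continuous_subtype_val).div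
      (continuous_norm.comp continuous_subtype_val) fun p => (hnormpos p).ne'
  -- Relative to the largest coordinate, `α` is 1 exactly where the ratio is at least 1/2, and its
  -- support is that of `p`.
  let α : (nerveComplex C).realization → ι → ℝ := fun p i => min 1 (2 * (p.1 i / ‖p.1‖))
  have hα : Continuous α :=
    continuous_pi fun i => continuous_const.min (continuous_const.mul (hcoord i))
  have hαmem : ∀ p, α p ∈ cubicalNerve C := fun p => by
    obtain ⟨i, hi, hpos⟩ := hmax p
    have h1 : α p i = 1 := by
      simp only [α, hi, div_self hpos.ne']
      norm_num
    refine ⟨fun j => ⟨le_min zero_le_one ?_, min_le_left _ _⟩, ⟨i, h1⟩,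
      (isAdmissible_suppSet p).mono ⟨i, mem_suppSet.2 (by simp [h1])⟩ fun j hj => ?_⟩
    · exact mul_nonneg zero_le_two (div_nonneg (hnn p j) hpos.le)
    · rw [mem_suppSet] at hj ⊢
      intro h
      simp [α, h] at hj
  have hψA : ∀ p, ψ (α p) ∈ A := fun p => by
    obtain ⟨i, hi⟩ := (hαmem p).2.1
    exact Set.mem_iUnion.2 ⟨i, hψC _ (hαmem p) i hi⟩
  let Ψ : C((nerveComplex C).realization, A) :=
    ⟨fun p => ⟨ψ (α p), hψA p⟩, (hψ.comp_continuous hα hαmem).subtype_mk _⟩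
  -- The support of `v p` lies in that of `p` and in the set where `α p` is 1. The first inclusion
  -- links its normalization `q` to the identity, the second to `Φ ∘ Ψ`.
  let v : (nerveComplex C).realization → ι → ℝ := fun p i => max 0 (p.1 i / ‖p.1‖ - 1 / 2)
  have hvpos : ∀ p, ∃ i, 0 < v p i := fun p => by
    obtain ⟨i, hi, hpos⟩ := hmax p
    refine ⟨i, lt_max_of_lt_right ?_⟩
    rw [hi, div_self hpos.ne']
    norm_num
  have hvhalf : ∀ p, ∀ i ∈ suppSet (v p), 1 / 2 < p.1 i / ‖p.1‖ := fun p i hi => by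
    rw [mem_suppSet] at hi
    by_contra h
    exact hi (max_eq_left (sub_nonpos.2 (not_lt.1 h)))
  have hvsupp : ∀ p, suppSet (v p) ⊆ suppSet p.1 := fun p i hi => by
    rw [mem_suppSet]
    intro h
    have := hvhalf p i hi
    rw [h, zero_div] at this
    norm_num at this
  obtain ⟨q, hq⟩ := exists_normalized_map (C := C) (v := v)
    (continuous_pi fun i => continuous_const.max ((hcoord i).sub continuous_const))
    (fun p i => le_max_left _ _) hvpos fun p => by
      obtain ⟨i, hi⟩ := hvpos p
      exact (isAdmissible_suppSet p).mono ⟨i, mem_suppSet.2 hi.ne'⟩ (hvsupp p)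
  have h1 : (ContinuousMap.id (nerveComplex C).realization).Homotopic q :=
    homotopic_of_suppSet_subset _ _ fun p => ⟨_, isAdmissible_suppSet p, subset_rfl,
      (hq p).trans_subset (hvsupp p)⟩
  have h2 : q.Homotopic (Φ.comp Ψ) :=
    homotopic_of_suppSet_subset _ _ fun p => by
      refine ⟨_, hsuppφ (Ψ p), (hq p).trans_subset fun i hi => ?_, (hΦ (Ψ p)).subset⟩
      -- Here `Ψ p` lies in `C i`, so the bump function `φ i` is positive there.
      have hone : α p i = 1 := min_eq_left (by linarith [hvhalf p i hi])
      exact mem_suppSet.2 (hφC i _ (hψC _ (hαmem p) i hone)).ne'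
  obtain ⟨F, hF⟩ := hdim A hA r hr (f.comp Φ)
  have hfF : f.comp (Φ.comp Ψ) =
      F.comp ((⟨Subtype.val, continuous_subtype_val⟩ : C(A, X)).comp Ψ) := by
    ext1 p
    exact (hF (Ψ p)).symm
  obtain ⟨y, hy⟩ := (hX r hr F).comp_left
    ((⟨Subtype.val, continuous_subtype_val⟩ : C(A, X)).comp Ψ)
  refine ⟨y, ?_⟩
  have h3 : f.Homotopic (f.comp (Φ.comp Ψ)) :=
    ContinuousMap.Homotopic.comp (ContinuousMap.Homotopic.refl f) (h1.trans h2)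
  rw [hfF] at h3
  exact h3.trans hy

end Nerve

/-! ### Convex metrics, CAT(0) spaces and contractibility -/

section Geodesics

variable {X : Type*} [MetricSpace X]

/-- A reparametrized piece of a geodesic is a geodesic. -/
theorem IsGeodesic.segment {c : ℝ → X} (hc : IsGeodesic c) {a b : ℝ}
    (ha : a ∈ Set.Icc (0 : ℝ) 1) (hb : b ∈ Set.Icc (0 : ℝ) 1) :
    IsGeodesic fun t => c (a + t * (b - a)) := by
  have hmem : ∀ t ∈ Set.Icc (0 : ℝ) 1, a + t * (b - a) ∈ Set.Icc (0 : ℝ) 1 := fun t ht => by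
    have := convex_Icc (0 : ℝ) 1 ha hb (sub_nonneg.2 ht.2) ht.1 (sub_add_cancel _ _)
    convert! this using 1
    simp only [smul_eq_mul]
    ring
  intro s hs t ht
  dsimp only
  rw [hc _ (hmem s hs) _ (hmem t ht), hc _ (hmem 0 (by simp)) _ (hmem 1 (by simp)), ← mul_assoc,
    ← abs_mul]
  have h1 : a + s * (b - a) - (a + t * (b - a)) = (s - t) * (b - a) := by ring
  have h2 : (s - t) * (a + 0 * (b - a) - (a + 1 * (b - a))) = -((s - t) * (b - a)) := by ring
  rw [h1, h2, abs_neg]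

/-- Euclidean triangles with given side lengths exist. -/
theorem exists_euclidean_triangle {a b c : ℝ} (ha : 0 ≤ a) (hb : 0 ≤ b) (hc : 0 ≤ c)
    (h1 : a ≤ b + c) (h2 : b ≤ a + c) (h3 : c ≤ a + b) :
    ∃ P Q R : EuclideanSpace ℝ (Fin 2), dist P Q = a ∧ dist P R = b ∧ dist Q R = c := by
  -- The first coordinate of `R`, by the law of cosines; for `a = 0` division by zero gives `x = 0`,
  -- while the triangle inequalities force `b = c`.
  let x : ℝ := (a ^ 2 + b ^ 2 - c ^ 2) / (2 * a)
  have hx : 2 * a * x = a ^ 2 + b ^ 2 - c ^ 2 := by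
    rcases ha.eq_or_lt with rfl | ha
    · have : b = c := by linarith
      simp [this]
    · simp only [x]
      field_simp
  have hxb : 0 ≤ b ^ 2 - x ^ 2 := by
    rcases ha.eq_or_lt with rfl | ha
    · simp only [x]
      simpa using sq_nonneg b
    · have h : 0 ≤ (2 * a) ^ 2 * (b ^ 2 - x ^ 2) := by
        -- Heron's formula, with factors nonnegative by the triangle inequalities.
        have : (2 * a) ^ 2 * (b ^ 2 - x ^ 2) = ((c + a - b) * (c + b - a)) *
            ((a + b - c) * (a + b + c)) := by
          have : (2 * a) ^ 2 * (b ^ 2 - x ^ 2) = (2 * a * b) ^ 2 - (2 * a * x) ^ 2 := by ring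
          rw [this, hx]
          ring
        rw [this]
        refine mul_nonneg (mul_nonneg ?_ ?_) (mul_nonneg ?_ ?_) <;> linarith
      exact nonneg_of_mul_nonneg_right h (by positivity)
  refine ⟨!₂[0, 0], !₂[a, 0], !₂[x, Real.sqrt (b ^ 2 - x ^ 2)], ?_, ?_, ?_⟩
  · simp [EuclideanSpace.dist_eq, Real.dist_eq, Real.sqrt_sq ha]
  · simp [EuclideanSpace.dist_eq, Real.dist_eq, Real.sq_sqrt hxb, Real.sqrt_sq hb]
  · simp only [EuclideanSpace.dist_eq, Real.dist_eq, sq_abs, Fin.sum_univ_two]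
    simp only [Matrix.cons_val_zero, Matrix.cons_val_one, zero_sub, neg_sq,
      Real.sq_sqrt hxb]
    have : (a - x) ^ 2 + (b ^ 2 - x ^ 2) = c ^ 2 := by linarith
    rw [this, Real.sqrt_sq hc]

theorem IsCATZeroSpace.dist_le_mul (hX : IsCATZeroSpace X) {c₁ c₂ : ℝ → X} (h₁ : IsGeodesic c₁)
    (h₂ : IsGeodesic c₂) (h : c₁ 0 = c₂ 0) {t : ℝ} (ht : t ∈ Set.Icc (0 : ℝ) 1) :
    dist (c₁ t) (c₂ t) ≤ t * dist (c₁ 1) (c₂ 1) := by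
  obtain ⟨P, Q, R, hPQ, hPR, hQR⟩ := exists_euclidean_triangle
    (dist_nonneg (x := c₁ 0) (y := c₁ 1)) (dist_nonneg (x := c₂ 0) (y := c₂ 1))
    (dist_nonneg (x := c₁ 1) (y := c₂ 1))
    (by rw [h, dist_comm (c₁ 1)]; exact dist_triangle _ _ _)
    (by rw [← h]; exact dist_triangle _ _ _)
    (by rw [dist_comm (c₁ 0), h]; exact dist_triangle _ _ _)
  refine (hX.2 c₁ c₂ h₁ h₂ h P Q R hPQ hPR hQR t ht t ht).trans_eq ?_
  have : AffineMap.lineMap P Q t - AffineMap.lineMap P R t = t • (Q - R) := by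
    simp only [AffineMap.lineMap_apply, vsub_eq_sub, vadd_eq_add, add_sub_add_right_eq_sub,
      ← smul_sub, sub_sub_sub_cancel_right]
  rw [dist_eq_norm, this, norm_smul, Real.norm_of_nonneg ht.1, ← dist_eq_norm, hQR]

/-- A diagonal from `c₁ 0` to `c₂ 1` cuts the quadrilateral into two triangles. The second has its
apex at `c₂ 1`, so its sides are reversed and compared at time `1 - t`. -/
theorem IsCATZeroSpace.dist_le (hX : IsCATZeroSpace X) {c₁ c₂ : ℝ → X} (h₁ : IsGeodesic c₁)
    (h₂ : IsGeodesic c₂) {t : ℝ} (ht : t ∈ Set.Icc (0 : ℝ) 1) :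
    dist (c₁ t) (c₂ t) ≤ (1 - t) * dist (c₁ 0) (c₂ 0) + t * dist (c₁ 1) (c₂ 1) := by
  obtain ⟨c, hc, hc0, hc1⟩ := hX.1 (c₁ 0) (c₂ 1)
  have hl := hX.dist_le_mul h₁ hc hc0.symm ht
  have ht' : 1 - t ∈ Set.Icc (0 : ℝ) 1 := ⟨sub_nonneg.2 ht.2, sub_le_self _ ht.1⟩
  have hr := hX.dist_le_mul (hc.segment (a := 1) (b := 0) (by simp) (by simp))
    (h₂.segment (a := 1) (b := 0) (by simp) (by simp)) (by simpa using hc1) ht'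
  have e1 : (1 : ℝ) + (1 - t) * (0 - 1) = t := by ring
  have e2 : (1 : ℝ) + 1 * (0 - 1) = 0 := by ring
  rw [e1, e2, hc0] at hr
  rw [hc1] at hl
  linarith [dist_triangle (c₁ t) (c t) (c₂ t)]

/-- `CAT(0)` spaces are convex metric spaces. -/
theorem IsCATZeroSpace.isConvexMetricSpace (hX : IsCATZeroSpace X) : IsConvexMetricSpace X := by
  refine ⟨hX.1, fun c₁ c₂ h₁ h₂ => ⟨convex_Icc _ _, fun x hx y hy a b ha hb hab => ?_⟩⟩
  -- Restricting both geodesics to `[x, y]` reduces convexity to the endpoint estimate.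
  have h := hX.dist_le (h₁.segment hx hy) (h₂.segment hx hy) (t := b) ⟨hb, by linarith⟩
  have e : a • x + b • y = x + b * (y - x) := by
    simp only [smul_eq_mul]
    linear_combination x * hab
  have ha' : 1 - b = a := by linarith
  rw [e]
  simpa [ha'] using h

/-- Nonempty geodesically convex subsets of convex metric spaces are contractible. -/
theorem IsGeodesicallyConvex.contractibleSpace (hX : IsConvexMetricSpace X) {Y : Set X}
    (hY : IsGeodesicallyConvex Y) (hne : Y.Nonempty) : ContractibleSpace Y := by
  obtain ⟨x₀, hx₀⟩ := hne
  -- Any choice of geodesics will do: convexity makes them depend continuously on the endpoint.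
  choose γ hγ hγ0 hγ1 using hX.1 x₀
  have hle : ∀ x y, ∀ t ∈ Set.Icc (0 : ℝ) 1, dist (γ x t) (γ y t) ≤ dist x y := by
    intro x y t ht
    have := (hX.2 _ _ (hγ x) (hγ y)).2 (x := 0) (y := 1) (by simp) (by simp)
      (sub_nonneg.2 ht.2) ht.1 (sub_add_cancel _ _)
    simp only [smul_eq_mul, mul_zero, mul_one, zero_add, hγ0, hγ1, dist_self] at this
    exact this.trans (mul_le_of_le_one_left dist_nonneg ht.2)
  -- Time is reversed so that the homotopy starts at the identity and ends at `x₀`.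
  have hcont : Continuous fun q : unitInterval × Y => γ q.2.1 (1 - (q.1 : ℝ)) := by
    rw [continuous_iff_continuousAt]
    rintro ⟨s, x⟩
    rw [ContinuousAt, tendsto_iff_dist_tendsto_zero]
    have hlim : Filter.Tendsto (fun q : unitInterval × Y =>
        dist q.2.1 x.1 + |(1 - (q.1 : ℝ)) - (1 - (s : ℝ))| * dist x₀ x.1) (nhds (s, x))
        (nhds 0) := by
      have : Continuous fun q : unitInterval × Y =>
          dist q.2.1 x.1 + |(1 - (q.1 : ℝ)) - (1 - (s : ℝ))| * dist x₀ x.1 := by fun_prop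
      simpa using this.tendsto (s, x)
    refine squeeze_zero (fun _ => dist_nonneg) (fun q => ?_) hlim
    have h1 : ∀ t : unitInterval, 1 - (t : ℝ) ∈ Set.Icc (0 : ℝ) 1 := fun t =>
      ⟨sub_nonneg.2 t.2.2, sub_le_self _ t.2.1⟩
    refine (dist_triangle _ (γ x.1 (1 - (q.1 : ℝ))) _).trans
      (add_le_add (hle _ _ _ (h1 _)) ?_)
    rw [hγ x.1 _ (h1 _) _ (h1 _), hγ0, hγ1]
  rw [contractible_iff_id_nullhomotopic]
  have hmem : ∀ q : unitInterval × Y, γ q.2.1 (1 - (q.1 : ℝ)) ∈ Y := fun q => by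
    refine hY _ (hγ _) ?_ ?_ _ ⟨sub_nonneg.2 q.1.2.2, sub_le_self _ q.1.2.1⟩
    · rwa [hγ0]
    · rw [hγ1]
      exact q.2.2
  refine ⟨⟨x₀, hx₀⟩, ⟨⟨⟨fun q => ⟨_, hmem q⟩, hcont.subtype_mk hmem⟩, ?_, ?_⟩⟩⟩
  · intro y
    apply Subtype.ext
    simp [hγ1]
  · intro y
    apply Subtype.ext
    simp [hγ0]

theorem IsGeodesicallyConvex.biInter {ι : Type*} {C : ι → Set X}
    (hC : ∀ i, IsGeodesicallyConvex (C i)) (I : Finset ι) :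
    IsGeodesicallyConvex (⋂ i ∈ I, C i) := fun c hc h0 h1 t ht =>
  Set.mem_iInter₂.2 fun i hi =>
    hC i c hc (Set.mem_iInter₂.1 h0 i hi) (Set.mem_iInter₂.1 h1 i hi) t ht

/-- Each admissible intersection is convex, hence contractible, hence `k`-connected for every `k`.
-/
theorem sufficientlyConnected_of_isGeodesicallyConvex {ι : Type*} [Fintype ι] {C : ι → Set X}
    (hX : IsConvexMetricSpace X) (hC : ∀ i, IsGeodesicallyConvex (C i)) :
    SufficientlyConnected C := by
  intro I hI
  have := (IsGeodesicallyConvex.biInter hC I).contractibleSpace hX hI.2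
  refine ⟨fun _ => isConnected_iff_connectedSpace.2 inferInstance, fun _ =>
    ⟨hI.2.to_subtype, fun i _ f => ?_⟩⟩
  exact (id_nullhomotopic _).comp_left f

theorem IsConvexMetricSpace.isCoconnected (hX : IsConvexMetricSpace X) (d : ℕ) :
    IsCoconnected X d := by
  intro r _ f
  rcases isEmpty_or_nonempty X with h | h
  · let y : UnitSphere r := ⟨EuclideanSpace.single 0 1, by simp⟩
    have : f = ContinuousMap.const _ y := by
      ext1 p
      exact h.elim p
    rw [this]
    exact ContinuousMap.nullhomotopic_of_constant y
  · have huniv : IsGeodesicallyConvex (Set.univ : Set X) := fun _ _ _ _ _ _ => Set.mem_univ _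
    have := huniv.contractibleSpace hX Set.univ_nonempty
    have : ContractibleSpace X := (Homeomorph.Set.univ X).symm.contractibleSpace
    exact (id_nullhomotopic X).comp_right f

end Geodesics

/-! ### The theorem for coconnected, convex and CAT(0) spaces -/

theorem theoremt {X : Type*} [MetricSpace X] (d : ℕ) (hdim : DimLE X d)
    {ι : Type*} [Fintype ι] (C : ι → Set X) (hclosed : ∀ i, IsClosed (C i)) :
    (IsCoconnected X d → SufficientlyConnected C →
      ∀ r : ℕ, d ≤ r → ∀ f : C((nerveComplex C).realization, UnitSphere r), f.Nullhomotopic) ∧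
    (CompleteSpace X → IsConvexMetricSpace X → (∀ i, IsGeodesicallyConvex (C i)) →
      ∀ r : ℕ, d ≤ r → ∀ f : C((nerveComplex C).realization, UnitSphere r), f.Nullhomotopic) ∧
    (CompleteSpace X → IsCATZeroSpace X → (∀ i, IsGeodesicallyConvex (C i)) →
      ∀ r : ℕ, d ≤ r → ∀ f : C((nerveComplex C).realization, UnitSphere r), f.Nullhomotopic) := by
  have hconvex : IsConvexMetricSpace X → (∀ i, IsGeodesicallyConvex (C i)) →
      IsCoconnected (nerveComplex C).realization d := fun hX hC =>
    (sufficientlyConnected_of_isGeodesicallyConvex hX hC).nerve_isCoconnected hdim hclosed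
      (hX.isCoconnected d)
  exact ⟨fun hX hC => hC.nerve_isCoconnected hdim hclosed hX, fun _ hX hC => hconvex hX hC,
    fun _ hX hC => hconvex hX.isConvexMetricSpace hC⟩
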